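/- **Theorem 3.1.** Let $p,q\in\mathbb C[x]$ and consider the Abel equation $$y'=p(x)y^2+q(x)y^3. \qquad (1)$$ For $a,w\in\mathbb C$ let $y(w,\cdot)$ denote the local analytic solution of (1) near $a$ with $y(w,a)=w$. A solution $y(w,\cdot)$ is said to be *regular along* a path $s$ from $a$ to $b$ if it can be analytically continued from $a$ along the whole of $s$, endpoint $b$ included. If $y(w^0,\cdot)$ is regular along $s$, the germ at $w^0$ of the Poincaré map, denoted $\varphi_{a,b,s,w^0}$, sends each $w$ near $w^0$ to the value at $b$ of the solution $y(w,\cdot)$ continued along $s$. Paths are continuous and parametrized by $[0,1]$. Let $a,b\in\mathbb C$, let $\sigma:[0,1]\to\mathbb C$ be a path of initial values from $w_0=\sigma(0)$ to $w_1=\sigma(1)$, and let $s$ be a path from $a$ to $b$. Suppose that there is a family $s_t$, $t\in[0,1]$, of paths from $a$ to $b$ such that 1. $s_t$ is a continuous deformation of $s$ with fixed endpoints, i.e. $(t,\tau)\mapsto s_t(\tau)$ is continuous on $[0,1]^2$ and $s_0=s$; 2. for each $t\in[0,1]$ the solution $y(\sigma(t),\cdot)$ is regular along $s_t$. Then the germs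 $\varphi_{a,b,s,w_0}$ and $\varphi_{a,b,s_1,w_1}$ are well defined, the germ $\varphi_{a,b,s,w_0}$ can be analytically continued along $\sigma$ from $w_0$ to $w_1$, and the germ at $w_1$ obtained by this continuation (by any such continuation) is $\varphi_{a,b,s_1,w_1}$. -/

import Mathlib

open Filter Topology Polynomial

/-- `f` is an analytic continuation along the path `γ`: each `f t` represents an analytic germ at
`γ t`, and for `t'` close to `t` the germs of `f t'` and of `f t` at `γ t'` coincide. -/
def IsAnalyticContinuation {x₀ x₁ : ℂ} (γ : Path x₀ x₁) (f : unitInterval → ℂ → ℂ) : Prop :=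
  (∀ t : unitInterval, AnalyticAt ℂ (f t) (γ t)) ∧
    ∀ t : unitInterval, ∀ᶠ t' in 𝓝 t, f t' =ᶠ[𝓝 (γ t')] f t

/-- `y` is, near `a`, the solution of `y' = p(x) y² + q(x) y³` with `y(a) = w`. -/
def IsLocalAbelSolution (p q : ℂ[X]) (a w : ℂ) (y : ℂ → ℂ) : Prop :=
  y a = w ∧ ∀ᶠ x in 𝓝 a, HasDerivAt y (p.eval x * y x ^ 2 + q.eval x * y x ^ 3) x

/-- `Y` is the analytic continuation along the whole of `s` (regular at every point of `s`,
endpoints included) of the solution of the Abel equation with value `w` at the initial point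
`a` of `s`. -/
def IsContinuedSolution (p q : ℂ[X]) {a b : ℂ} (s : Path a b) (w : ℂ) (Y : unitInterval → ℂ → ℂ) : Prop :=
  IsLocalAbelSolution p q a w (Y 0) ∧ IsAnalyticContinuation s Y

/-- The solution with value `w` at `a` can be continued along `s`, and is regular at each point
of `s`. -/
def IsRegularAlong (p q : ℂ[X]) {a b : ℂ} (s : Path a b) (w : ℂ) : Prop :=
  ∃ Y : unitInterval → ℂ → ℂ, IsContinuedSolution p q s w Y

/-- `v` is the value at `b` of the solution with value `w` at `a`, continued to `b` along `s`. -/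
def IsPoincareValue (p q : ℂ[X]) {a b : ℂ} (s : Path a b) (w v : ℂ) : Prop :=
  ∃ Y : unitInterval → ℂ → ℂ, IsContinuedSolution p q s w Y ∧ Y 1 b = v

open Classical in
/-- The Poincaré mapping along `s`: `w` is sent to the value at `b` of the solution with value
`w` at `a`, continued along `s`. (The value `0` is assigned if there is no such continuation.) -/
noncomputable def poincareMap (p q : ℂ[X]) {a b : ℂ} (s : Path a b) (w : ℂ) : ℂ :=
  if h : ∃ v : ℂ, IsPoincareValue p q s w v then h.choose else 0

/-- The germ of the Poincaré mapping at `w₀` is well defined: for every initial value near `w₀`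
the continuation along `s` exists and determines exactly one value at `b`. -/
def PoincareGermDefined (p q : ℂ[X]) {a b : ℂ} (s : Path a b) (w₀ : ℂ) : Prop :=
  ∀ᶠ w in 𝓝 w₀, ∃! v : ℂ, IsPoincareValue p q s w v

/-! A solution continued along a path lies in a tube: nearby initial values give solutions on discs
of one fixed radius about all points of the path, and their values depend analytically on the
initial value. These discs also carry the continuation along every path uniformly close to the given
one. Hence one analytic function `F` is the Poincaré map near `σ t` for all such paths
(`IsRegularAlong.exists_analyticAt`). By uniform continuity of the homotopy, `s_t'` is such a path
for `t'` near `t`, so the maps of `s_t` and `s_t'` have the same germ at `σ t'`. The Poincaré maps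
therefore form a continuation along `σ`, and the identity theorem makes it the only one.

Tubes are built from a holomorphic local flow (`exists_local_flow`), which comes from the implicit
function theorem in `C([0,1])` applied to the integral equation on a segment. -/

/-! ### The integral equation along a segment -/

/-- Integration from `0` as an operator on the continuous functions on `[0, 1]`. -/
noncomputable def integralFromZero : C(unitInterval, ℂ) →L[ℂ] C(unitInterval, ℂ) :=
  LinearMap.mkContinuous
    { toFun := fun u =>
        { toFun := fun τ => ∫ θ in (0 : ℝ)..τ, u (Set.projIcc 0 1 zero_le_one θ)
          continuous_toFun :=
            (intervalIntegral.continuous_primitive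
              (fun _ _ => (by fun_prop : Continuous fun θ : ℝ =>
                u (Set.projIcc 0 1 zero_le_one θ)).intervalIntegrable _ _) 0).comp
              continuous_subtype_val }
      map_add' := fun u v => by
        ext τ
        exact intervalIntegral.integral_add
          ((by fun_prop : Continuous fun θ : ℝ =>
            u (Set.projIcc 0 1 zero_le_one θ)).intervalIntegrable _ _)
          ((by fun_prop : Continuous fun θ : ℝ =>
            v (Set.projIcc 0 1 zero_le_one θ)).intervalIntegrable _ _)
      map_smul' := fun c u => by
        ext τ
        exact intervalIntegral.integral_smul c _ }
    1 (fun u => by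
      rw [one_mul]
      refine (ContinuousMap.norm_le _ (norm_nonneg u)).2 fun τ => ?_
      refine (intervalIntegral.norm_integral_le_of_norm_le_const
        (C := ‖u‖) fun θ _ => u.norm_coe_le_norm _).trans ?_
      rw [sub_zero, abs_of_nonneg τ.2.1]
      exact mul_le_of_le_one_right (norm_nonneg u) τ.2.2)

theorem integralFromZero_apply (u : C(unitInterval, ℂ)) (τ : unitInterval) :
    integralFromZero u τ = ∫ θ in (0 : ℝ)..τ, u (Set.projIcc 0 1 zero_le_one θ) := rfl

/-- Precomposition with multiplication by `μ`. -/
noncomputable def rescale (μ : unitInterval) (u : C(unitInterval, ℂ)) : C(unitInterval, ℂ) :=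
  u.comp ⟨fun τ => μ * τ, by fun_prop⟩

theorem rescale_apply (μ : unitInterval) (u : C(unitInterval, ℂ)) (τ : unitInterval) :
    rescale μ u τ = u (μ * τ) := rfl

theorem integralFromZero_mul (μ τ : unitInterval) (u : C(unitInterval, ℂ)) :
    integralFromZero u (μ * τ) = (μ : ℂ) * integralFromZero (rescale μ u) τ := by
  rw [integralFromZero_apply, integralFromZero_apply]
  have h := intervalIntegral.smul_integral_comp_mul_left (a := 0) (b := (τ : ℝ))
    (fun θ : ℝ => u (Set.projIcc 0 1 zero_le_one θ)) (μ : ℝ)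
  rw [mul_zero] at h
  rw [Set.Icc.coe_mul, ← h, Complex.real_smul]
  congr 1
  refine intervalIntegral.integral_congr fun θ hθ => ?_
  rw [Set.uIcc_of_le τ.2.1] at hθ
  have h1 : θ ∈ Set.Icc (0 : ℝ) 1 := ⟨hθ.1, hθ.2.trans τ.2.2⟩
  simp only [rescale_apply]
  rw [Set.projIcc_of_mem _ h1]
  congr 1
  have h2 : (μ : ℝ) * θ ∈ Set.Icc (0 : ℝ) 1 := (μ * ⟨θ, h1⟩ : unitInterval).2
  rw [Set.projIcc_of_mem _ h2]
  rfl

/-- The polynomial `r` along the segment from `x₁` to `x`. -/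
noncomputable def alongSegment (r : ℂ[X]) (x₁ x : ℂ) : C(unitInterval, ℂ) :=
  aeval (algebraMap ℂ C(unitInterval, ℂ) x₁ +
    (x - x₁) • (⟨fun τ => ((τ : ℝ) : ℂ), by fun_prop⟩ : C(unitInterval, ℂ))) r

theorem alongSegment_apply (r : ℂ[X]) (x₁ x : ℂ) (τ : unitInterval) :
    alongSegment r x₁ x τ = r.eval (x₁ + (x - x₁) * (τ : ℝ)) := by
  have h := Polynomial.aeval_algHom_apply (ContinuousMap.evalAlgHom ℂ ℂ τ)
    (algebraMap ℂ C(unitInterval, ℂ) x₁ +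
    (x - x₁) • (⟨fun τ => ((τ : ℝ) : ℂ), by fun_prop⟩ : C(unitInterval, ℂ))) r
  rw [coe_aeval_eq_eval] at h
  exact h.symm

theorem contDiff_aeval_of_contDiff {E A : Type*} [NormedAddCommGroup E] [NormedSpace ℂ E]
    [NormedCommRing A] [NormedAlgebra ℂ A] {n : WithTop ℕ∞} {g : E → A} (hg : ContDiff ℂ n g)
    (r : ℂ[X]) : ContDiff ℂ n fun x => aeval (g x) r := by
  induction r using Polynomial.induction_on' with
  | add f g hf hg => simpa using hf.add hg
  | monomial k c => simpa [aeval_monomial] using contDiff_const.mul (hg.pow k)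

/-- The defect in the integral equation for the Abel equation along the segment from `x₁` to `x`
with initial value `v`. The argument is `((x₁, x, v), u)`. -/
noncomputable def abelDefect (p q : ℂ[X]) (z : (ℂ × ℂ × ℂ) × C(unitInterval, ℂ)) :
    C(unitInterval, ℂ) :=
  z.2 - algebraMap ℂ C(unitInterval, ℂ) z.1.2.2 - (z.1.2.1 - z.1.1) •
    integralFromZero (alongSegment p z.1.1 z.1.2.1 * z.2 ^ 2 +
      alongSegment q z.1.1 z.1.2.1 * z.2 ^ 3)

theorem contDiff_abelDefect (p q : ℂ[X]) : ContDiff ℂ 1 (abelDefect p q) := by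
  have hC : ContDiff ℂ 1 (algebraMap ℂ C(unitInterval, ℂ)) :=
    (Algebra.linearMap ℂ C(unitInterval, ℂ)).mkContinuous 1 (fun x => by simp) |>.contDiff
  have hs (r : ℂ[X]) : ContDiff ℂ 1 fun z : (ℂ × ℂ × ℂ) × C(unitInterval, ℂ) =>
      alongSegment r z.1.1 z.1.2.1 := by
    refine contDiff_aeval_of_contDiff ?_ r
    have h1 : ContDiff ℂ 1 fun z : (ℂ × ℂ × ℂ) × C(unitInterval, ℂ) => z.1.1 := by fun_prop
    have h2 : ContDiff ℂ 1 fun z : (ℂ × ℂ × ℂ) × C(unitInterval, ℂ) => z.1.2.1 - z.1.1 := by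
      fun_prop
    exact (hC.comp h1).add (h2.smul contDiff_const)
  have h1 : ContDiff ℂ 1 fun z : (ℂ × ℂ × ℂ) × C(unitInterval, ℂ) =>
      algebraMap ℂ C(unitInterval, ℂ) z.1.2.2 := hC.comp (by fun_prop)
  have h2 := ((hs p).mul (contDiff_snd.pow 2)).add ((hs q).mul (contDiff_snd.pow 3))
  have h3 : ContDiff ℂ 1 fun z : (ℂ × ℂ × ℂ) × C(unitInterval, ℂ) => z.1.2.1 - z.1.1 := by
    fun_prop
  exact (contDiff_snd.sub h1).sub (h3.smul (integralFromZero.contDiff.comp h2))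

/-- On a degenerate segment the integral term vanishes. The derivative in `u` is then the identity,
which is the invertibility needed for the implicit function theorem. -/
theorem abelDefect_self (p q : ℂ[X]) (x v : ℂ) (u : C(unitInterval, ℂ)) :
    abelDefect p q ((x, x, v), u) = u - algebraMap ℂ C(unitInterval, ℂ) v := by
  have h (f : C(unitInterval, ℂ)) : (x - x) • f = 0 := by
    ext τ
    rw [sub_self, ContinuousMap.smul_apply, zero_smul, ContinuousMap.zero_apply]
  rw [abelDefect, h, sub_zero]

theorem abelDefect_eq_zero_iff {p q : ℂ[X]} {x₁ x v : ℂ} {u : C(unitInterval, ℂ)} :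
    abelDefect p q ((x₁, x, v), u) = 0 ↔ ∀ τ, u τ = v + (x - x₁) *
      integralFromZero (alongSegment p x₁ x * u ^ 2 + alongSegment q x₁ x * u ^ 3) τ := by
  rw [abelDefect, sub_sub, sub_eq_zero, ContinuousMap.ext_iff]
  rfl

/-- Cutting a solution off at the fraction `μ` of the segment solves the equation on the shorter
segment. With local uniqueness, this identifies the solutions for all endpoints on one segment. -/
theorem abelDefect_rescale {p q : ℂ[X]} {x₁ x v : ℂ} {u : C(unitInterval, ℂ)}
    (h : abelDefect p q ((x₁, x, v), u) = 0) (μ : unitInterval) :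
    abelDefect p q ((x₁, x₁ + (x - x₁) * (μ : ℝ), v), rescale μ u) = 0 := by
  rw [abelDefect_eq_zero_iff] at h ⊢
  intro τ
  rw [rescale_apply, h, integralFromZero_mul]
  have : rescale μ (alongSegment p x₁ x * u ^ 2 + alongSegment q x₁ x * u ^ 3) =
      alongSegment p x₁ (x₁ + (x - x₁) * (μ : ℝ)) * rescale μ u ^ 2 +
        alongSegment q x₁ (x₁ + (x - x₁) * (μ : ℝ)) * rescale μ u ^ 3 := by
    ext τ
    simp [rescale_apply, alongSegment_apply, mul_assoc]
  rw [this]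
  ring

/-- A function that agrees along the segment from `x₁` to `x` with the solution of the integral
equation satisfies the Abel equation at `x`. -/
theorem deriv_eq_of_abelDefect_eq_zero {p q : ℂ[X]} {x₁ x v : ℂ} {u : C(unitInterval, ℂ)}
    {y : ℂ → ℂ} (h : abelDefect p q ((x₁, x, v), u) = 0) (hx : x ≠ x₁)
    (hy : ∀ μ : unitInterval, y (x₁ + (x - x₁) * (μ : ℝ)) = u μ) (hd : DifferentiableAt ℂ y x) :
    deriv y x = p.eval x * y x ^ 2 + q.eval x * y x ^ 3 := by
  set g := alongSegment p x₁ x * u ^ 2 + alongSegment q x₁ x * u ^ 3 with hg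
  have hg' : Continuous fun θ : ℝ => g (Set.projIcc 0 1 zero_le_one θ) := by fun_prop
  have h1 : HasDerivAt (fun μ : ℝ => v + (x - x₁) * ∫ θ in (0 : ℝ)..μ,
      g (Set.projIcc 0 1 zero_le_one θ)) ((x - x₁) * g 1) 1 := by
    have := (hg'.integral_hasStrictDerivAt 0 1).hasDerivAt
    simpa using (this.const_mul (x - x₁)).const_add v
  have h2 : HasDerivAt (fun μ : ℝ => x₁ + (x - x₁) * (μ : ℂ)) (x - x₁) 1 := by
    simpa using ((Complex.ofRealCLM.hasDerivAt (x := (1 : ℝ))).const_mul (x - x₁)).const_add x₁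
  have h3 : HasDerivAt (fun μ : ℝ => y (x₁ + (x - x₁) * (μ : ℂ))) (deriv y x * (x - x₁)) 1 :=
    HasDerivAt.comp (h₂ := y) (1 : ℝ) (by simpa using hd.hasDerivAt) h2
  rw [abelDefect_eq_zero_iff] at h
  -- `u` is known only on `[0, 1]`, so the derivatives at the endpoint `1` are compared from one
  -- side.
  have h4 := h1.hasDerivWithinAt (s := Set.Icc 0 1)
  have h5 : HasDerivWithinAt (fun μ : ℝ => y (x₁ + (x - x₁) * (μ : ℂ))) ((x - x₁) * g 1)
      (Set.Icc 0 1) 1 := by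
    refine h4.congr (fun μ hμ => ?_) ?_
    · exact (hy ⟨μ, hμ⟩).trans (h ⟨μ, hμ⟩)
    · exact (hy 1).trans (h 1)
  have h6 := (uniqueDiffOn_Icc zero_lt_one 1 (by simp)).eq_deriv _ h3.hasDerivWithinAt h5
  have h7 := hy 1
  simp only [Set.Icc.coe_one, Complex.ofReal_one, mul_one, add_sub_cancel] at h7
  rw [mul_comm] at h6
  rw [mul_left_cancel₀ (sub_ne_zero.2 hx) h6, h7, hg]
  simp [alongSegment_apply]

/-! ### The local flow -/

/-- Local solutions of the Abel equation, on a disc independent of the initial point and of the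
initial value, with holomorphic dependence on the initial value. -/
theorem exists_local_flow (p q : ℂ[X]) (x₀ y₀ : ℂ) :
    ∃ ρ > 0, ∃ G : ℂ → ℂ → ℂ → ℂ, ∀ x₁ ∈ Metric.ball x₀ ρ,
      (∀ v ∈ Metric.ball y₀ ρ, G x₁ v x₁ = v ∧ ∀ x ∈ Metric.ball x₀ ρ,
        HasDerivAt (G x₁ v) (p.eval x * G x₁ v x ^ 2 + q.eval x * G x₁ v x ^ 3) x) ∧
      ∀ x ∈ Metric.ball x₀ ρ, DifferentiableOn ℂ (fun v => G x₁ v x) (Metric.ball y₀ ρ) := by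
  set c : C(unitInterval, ℂ) := algebraMap ℂ C(unitInterval, ℂ) y₀ with hc
  set z₀ : (ℂ × ℂ × ℂ) × C(unitInterval, ℂ) := ((x₀, x₀, y₀), c) with hz₀
  have hcd : ContDiffAt ℂ 1 (abelDefect p q) z₀ := (contDiff_abelDefect p q).contDiffAt
  have hF0 : abelDefect p q z₀ = 0 := by rw [hz₀, abelDefect_self, hc, sub_self]
  have hinv : (fderiv ℂ (abelDefect p q) z₀ ∘L
      .inr ℂ (ℂ × ℂ × ℂ) C(unitInterval, ℂ)).IsInvertible := by
    have h1 : HasFDerivAt (fun u => abelDefect p q ((x₀, x₀, y₀), u))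
        (fderiv ℂ (abelDefect p q) z₀ ∘L .inr ℂ (ℂ × ℂ × ℂ) C(unitInterval, ℂ)) c :=
      HasFDerivAt.comp c (hcd.differentiableAt one_ne_zero).hasFDerivAt
        (hasFDerivAt_prodMk_right (x₀, x₀, y₀) c)
    have h2 : HasFDerivAt (fun u => abelDefect p q ((x₀, x₀, y₀), u))
        (ContinuousLinearMap.id ℂ C(unitInterval, ℂ)) c := by
      have : (fun u => abelDefect p q ((x₀, x₀, y₀), u)) = fun u => u - c := by
        funext u
        exact abelDefect_self p q x₀ y₀ u
      rw [this]
      exact (hasFDerivAt_id c).sub_const c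
    rw [h1.unique h2]
    exact ⟨.refl ℂ _, rfl⟩
  set ψ := hcd.implicitFunction one_ne_zero hinv with hψ
  have hψ0 : ψ (x₀, x₀, y₀) = c := hcd.implicitFunction_apply_self one_ne_zero hinv
  have hψc : ContDiffAt ℂ 1 ψ (x₀, x₀, y₀) := hcd.contDiffAt_implicitFunction one_ne_zero hinv
  have e1 : ∀ᶠ l in 𝓝 (x₀, x₀, y₀), abelDefect p q (l, ψ l) = 0 := by
    have := hcd.eventually_apply_implicitFunction one_ne_zero hinv
    rwa [hF0] at this
  have e2 : ∀ᶠ z in 𝓝 z₀, abelDefect p q z = 0 → ψ z.1 = z.2 := by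
    have := hcd.eventually_apply_eq_iff_implicitFunction one_ne_zero hinv
    rw [hF0] at this
    exact this.mono fun z hz => hz.1
  obtain ⟨η, hη, e2⟩ := Metric.eventually_nhds_iff.1 e2
  have e3 : ∀ᶠ l in 𝓝 (x₀, x₀, y₀), dist (ψ l) c < η := by
    have := hψc.continuousAt.tendsto
    rw [hψ0] at this
    exact this.eventually (Metric.ball_mem_nhds c hη)
  have e4 : ∀ᶠ l in 𝓝 (x₀, x₀, y₀), DifferentiableAt ℂ ψ l :=
    (hψc.eventually (by simp)).mono fun l hl => hl.differentiableAt one_ne_zero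
  obtain ⟨ρ', hρ', e⟩ := Metric.eventually_nhds_iff.1 (e1.and (e3.and e4))
  -- The radius is also bounded by `η` so that the uniqueness statement `e2` applies to these
  -- parameters.
  have e' : ∀ x₁ ∈ Metric.ball x₀ (min ρ' η), ∀ x ∈ Metric.ball x₀ (min ρ' η),
      ∀ v ∈ Metric.ball y₀ (min ρ' η), abelDefect p q ((x₁, x, v), ψ (x₁, x, v)) = 0 ∧
        dist (ψ (x₁, x, v)) c < η ∧ DifferentiableAt ℂ ψ (x₁, x, v) := by
    intro x₁ hx₁ x hx v hv
    rw [Metric.mem_ball, lt_min_iff] at hx₁ hx hv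
    exact e (max_lt hx₁.1 (max_lt hx.1 hv.1))
  let ev : C(unitInterval, ℂ) →L[ℂ] ℂ := ContinuousMap.evalCLM ℂ 1
  refine ⟨min ρ' η, lt_min hρ' hη, fun x₁ v x => ev (ψ (x₁, x, v)), fun x₁ hx₁ => ⟨?_, ?_⟩⟩
  · intro v hv
    have hstart : ev (ψ (x₁, x₁, v)) = v := by
      have := abelDefect_eq_zero_iff.1 (e' x₁ hx₁ x₁ hx₁ v hv).1 1
      rwa [sub_self, zero_mul, add_zero] at this
    refine ⟨hstart, ?_⟩
    set y : ℂ → ℂ := fun x => ev (ψ (x₁, x, v)) with hy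
    have hdiff : ∀ x ∈ Metric.ball x₀ (min ρ' η), DifferentiableAt ℂ y x := fun x hx =>
      ev.differentiableAt.comp x ((e' x₁ hx₁ x hx v hv).2.2.comp x (by fun_prop))
    have hne : ∀ x ∈ Metric.ball x₀ (min ρ' η), x ≠ x₁ →
        deriv y x = p.eval x * y x ^ 2 + q.eval x * y x ^ 3 := by
      intro x hx hxx
      obtain ⟨h1, h2, -⟩ := e' x₁ hx₁ x hx v hv
      refine deriv_eq_of_abelDefect_eq_zero h1 hxx (fun μ => ?_) (hdiff x hx)
      have hm : x₁ + (x - x₁) * (μ : ℝ) ∈ Metric.ball x₀ (min ρ' η) := by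
        have := (convex_ball x₀ (min ρ' η)).add_smul_sub_mem hx₁ hx μ.2
        rwa [Complex.real_smul, mul_comm] at this
      -- Since `c` is constant, rescaling does not increase the distance to it.
      have h3 : dist (rescale μ (ψ (x₁, x, v))) c < η := by
        refine lt_of_le_of_lt ?_ h2
        refine (ContinuousMap.dist_le dist_nonneg).2 fun τ => ?_
        exact ContinuousMap.dist_apply_le_dist (f := ψ (x₁, x, v)) (g := c) (μ * τ)
      have h4 : dist (((x₁, x₁ + (x - x₁) * (μ : ℝ), v), rescale μ (ψ (x₁, x, v))) :
          (ℂ × ℂ × ℂ) × C(unitInterval, ℂ)) z₀ < η :=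
        max_lt (max_lt (lt_of_lt_of_le hx₁ (min_le_right _ _))
          (max_lt (lt_of_lt_of_le hm (min_le_right _ _))
            (lt_of_lt_of_le hv (min_le_right _ _)))) h3
      have h5 := e2 h4 (abelDefect_rescale h1 μ)
      have h6 := congrArg ev h5
      refine h6.trans ?_
      change rescale μ (ψ (x₁, x, v)) 1 = _
      rw [rescale_apply, mul_one]
    intro x hx
    suffices h : deriv y x = p.eval x * y x ^ 2 + q.eval x * y x ^ 3 by
      rw [← h]; exact (hdiff x hx).hasDerivAt
    have hball := Metric.isOpen_ball.mem_nhds hx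
    have han : AnalyticAt ℂ y x :=
      DifferentiableOn.analyticAt (fun x hx => (hdiff x hx).differentiableWithinAt) hball
    have hcy : ContinuousAt y x := han.continuousAt
    -- The argument along the segment fails at `x = x₁`; there the equation follows by continuity of
    -- both sides from the punctured neighbourhood.
    refine ((ContinuousAt.eventuallyEq_nhds_iff_eventuallyEq_nhdsNE han.deriv.continuousAt
      (g := fun x => p.eval x * y x ^ 2 + q.eval x * y x ^ 3) ?_).1 ?_).eq_of_nhds
    · exact ((p.continuous.continuousAt).mul (hcy.pow 2)).add
        ((q.continuous.continuousAt).mul (hcy.pow 3))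
    · have h1 : ∀ᶠ x' in 𝓝[≠] x, x' ≠ x₁ := by
        rcases eq_or_ne x x₁ with rfl | h
        · exact self_mem_nhdsWithin
        · exact mem_nhdsWithin_of_mem_nhds (isOpen_ne.mem_nhds h)
      filter_upwards [h1, mem_nhdsWithin_of_mem_nhds hball] with x' h2 h3 using hne x' h3 h2
  · intro x hx v hv
    exact (ev.differentiableAt.comp v ((e' x₁ hx₁ x hx v hv).2.2.comp v
      (by fun_prop))).differentiableWithinAt

/-! ### Uniqueness of solutions -/

/-- `y` solves the Abel equation at every point of `U`. -/
def IsAbelSolutionOn (p q : ℂ[X]) (y : ℂ → ℂ) (U : Set ℂ) : Prop :=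
  ∀ x ∈ U, HasDerivAt y (p.eval x * y x ^ 2 + q.eval x * y x ^ 3) x

namespace IsAbelSolutionOn

variable {p q : ℂ[X]} {y z : ℂ → ℂ} {U V : Set ℂ}

theorem mono (h : IsAbelSolutionOn p q y V) (hUV : U ⊆ V) : IsAbelSolutionOn p q y U :=
  fun x hx => h x (hUV hx)

theorem differentiableOn (h : IsAbelSolutionOn p q y U) : DifferentiableOn ℂ y U :=
  fun x hx => (h x hx).differentiableAt.differentiableWithinAt

theorem analyticOnNhd (h : IsAbelSolutionOn p q y U) (hU : IsOpen U) : AnalyticOnNhd ℂ y U :=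
  h.differentiableOn.analyticOnNhd hU

/-- Two solutions on a disc that agree at one point are equal. -/
theorem eqOn_ball {c : ℂ} {r : ℝ} (hy : IsAbelSolutionOn p q y (Metric.ball c r))
    (hz : IsAbelSolutionOn p q z (Metric.ball c r)) {x₁ : ℂ} (hx₁ : x₁ ∈ Metric.ball c r)
    (h : y x₁ = z x₁) : Set.EqOn y z (Metric.ball c r) := by
  have hdy := hy.differentiableOn
  have hdz := hz.differentiableOn
  have hp : DifferentiableOn ℂ (fun x => p.eval x) (Metric.ball c r) := p.differentiableOn
  have hq : DifferentiableOn ℂ (fun x => q.eval x) (Metric.ball c r) := q.differentiableOn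
  -- The difference of the solutions satisfies `(y - z)' = K (y - z)` with this `K`. For a primitive
  -- `k` of `K`, the product `(y - z) exp(-k)` is constant.
  have hK : DifferentiableOn ℂ (fun x => p.eval x * (y x + z x) +
      q.eval x * (y x ^ 2 + y x * z x + z x ^ 2)) (Metric.ball c r) :=
    (hp.mul (hdy.add hdz)).add (hq.mul (((hdy.pow 2).add (hdy.mul hdz)).add (hdz.pow 2)))
  obtain ⟨k, hk⟩ := hK.isExactOn_ball
  have hd : ∀ x ∈ Metric.ball c r,
      HasDerivAt (fun x => (y x - z x) * Complex.exp (-k x)) 0 x := by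
    intro x hx
    refine (((hy x hx).sub (hz x hx)).mul (hk x hx).neg.cexp).congr_deriv ?_
    simp only [Pi.sub_apply, Pi.neg_apply]
    ring
  intro x hx
  have := Metric.isOpen_ball.is_const_of_deriv_eq_zero (convex_ball c r).isPreconnected
    (fun x hx => (hd x hx).differentiableAt.differentiableWithinAt)
    (fun x hx => (hd x hx).deriv) hx hx₁
  simp only [h, sub_self, zero_mul, mul_eq_zero, Complex.exp_ne_zero, or_false] at this
  exact sub_eq_zero.1 this

end IsAbelSolutionOn

/-- The germ of a local solution is determined by its value at the initial point. -/
theorem IsLocalAbelSolution.eventuallyEq {p q : ℂ[X]} {a w : ℂ} {y z : ℂ → ℂ}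
    (hy : IsLocalAbelSolution p q a w y) (hz : IsLocalAbelSolution p q a w z) : y =ᶠ[𝓝 a] z := by
  obtain ⟨r, hr, h⟩ := Metric.eventually_nhds_iff_ball.1 (hy.2.and hz.2)
  have : Set.EqOn y z (Metric.ball a r) :=
    IsAbelSolutionOn.eqOn_ball (p := p) (q := q) (fun x hx => (h x hx).1) (fun x hx => (h x hx).2)
      (Metric.mem_ball_self hr) (hy.1.trans hz.1.symm)
  exact this.eventuallyEq_of_mem (Metric.ball_mem_nhds a hr)

/-! ### Continuation along a path -/

/-- A locally constant property defines a clopen set, and the interval is connected. This replaces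
subdividing the path into finitely many pieces. -/
theorem unitInterval_forall_of_eventually_iff {P : unitInterval → Prop} (h0 : P 0)
    (h : ∀ t, ∀ᶠ t' in 𝓝 t, P t' ↔ P t) (t : unitInterval) : P t := by
  have hc : IsClopen {t | P t} := by
    refine ⟨⟨isOpen_iff_mem_nhds.2 fun t ht => ?_⟩, isOpen_iff_mem_nhds.2 fun t ht => ?_⟩
    · exact (h t).mono fun t' h' => fun h1 => ht (h'.1 h1)
    · exact (h t).mono fun t' h' => h'.2 ht
  have := hc.eq_univ ⟨0, h0⟩
  exact this.symm.subset (Set.mem_univ t)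

namespace IsAnalyticContinuation

variable {x₀ x₁ : ℂ} {γ : Path x₀ x₁} {f g : unitInterval → ℂ → ℂ}

/-- Two continuations along a path with the same initial germ have the same germs. -/
theorem eventuallyEq (hf : IsAnalyticContinuation γ f) (hg : IsAnalyticContinuation γ g)
    (h : f 0 =ᶠ[𝓝 x₀] g 0) (t : unitInterval) : f t =ᶠ[𝓝 (γ t)] g t := by
  refine unitInterval_forall_of_eventually_iff (P := fun t => f t =ᶠ[𝓝 (γ t)] g t)
    (by rwa [γ.source]) (fun t => ?_) t
  obtain ⟨r, hr, han⟩ := Metric.eventually_nhds_iff_ball.1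
    ((hf.1 t).eventually_analyticAt.and (hg.1 t).eventually_analyticAt)
  have hb : ∀ᶠ t' in 𝓝 t, γ t' ∈ Metric.ball (γ t) r :=
    γ.continuous.continuousAt.eventually (Metric.ball_mem_nhds _ hr)
  have key : ∀ z₁ ∈ Metric.ball (γ t) r, ∀ z₂ ∈ Metric.ball (γ t) r,
      f t =ᶠ[𝓝 z₁] g t → f t =ᶠ[𝓝 z₂] g t := by
    intro z₁ hz₁ z₂ hz₂ he
    exact (AnalyticOnNhd.eqOn_of_preconnected_of_eventuallyEq (fun z hz => (han z hz).1)
      (fun z hz => (han z hz).2) (convex_ball _ _).isPreconnected hz₁ he).eventuallyEq_of_mem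
      (Metric.isOpen_ball.mem_nhds hz₂)
  filter_upwards [hb, hf.2 t, hg.2 t] with t' h1 h2 h3
  constructor
  · intro he
    exact key _ h1 _ (Metric.mem_ball_self hr) (h2.symm.trans (he.trans h3))
  · intro he
    exact h2.trans ((key _ (Metric.mem_ball_self hr) _ h1 he).trans h3.symm)

end IsAnalyticContinuation

namespace IsContinuedSolution

variable {p q : ℂ[X]} {a b w : ℂ} {s : Path a b} {Y Z : unitInterval → ℂ → ℂ}

theorem eventuallyEq (hY : IsContinuedSolution p q s w Y) (hZ : IsContinuedSolution p q s w Z)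
    (t : unitInterval) : Y t =ᶠ[𝓝 (s t)] Z t :=
  hY.2.eventuallyEq hZ.2 (hY.1.eventuallyEq hZ.1) t

/-- The continuation of a solution is a solution. -/
theorem eventually_hasDerivAt (hY : IsContinuedSolution p q s w Y) (t : unitInterval) :
    ∀ᶠ x in 𝓝 (s t), HasDerivAt (Y t) (p.eval x * Y t x ^ 2 + q.eval x * Y t x ^ 3) x := by
  -- Both sides of the differential equation are continuations along `s` with the same initial germ.
  have hf : IsAnalyticContinuation s fun t => deriv (Y t) :=
    ⟨fun t => (hY.2.1 t).deriv, fun t => (hY.2.2 t).mono fun t' h => h.deriv⟩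
  have hg : IsAnalyticContinuation s fun t x => p.eval x * Y t x ^ 2 + q.eval x * Y t x ^ 3 := by
    refine ⟨fun t => ?_, fun t => (hY.2.2 t).mono fun t' h => h.mono fun x hx => ?_⟩
    · have hr (r : ℂ[X]) : AnalyticAt ℂ (fun x => r.eval x) (s t) := by
        simpa using AnalyticAt.aeval_polynomial (analyticAt_id (𝕜 := ℂ) (z := s t)) r
      exact ((hr p).mul ((hY.2.1 t).pow 2)).add ((hr q).mul ((hY.2.1 t).pow 3))
    · simp only [hx]
  have h0 := hf.eventuallyEq hg (hY.1.2.mono fun x hx => hx.deriv) t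
  filter_upwards [h0, (hY.2.1 t).eventually_analyticAt] with x hx han
  rw [← hx]
  exact han.differentiableAt.hasDerivAt

end IsContinuedSolution

theorem IsPoincareValue.unique {p q : ℂ[X]} {a b w v v' : ℂ} {s : Path a b}
    (h : IsPoincareValue p q s w v) (h' : IsPoincareValue p q s w v') : v = v' := by
  obtain ⟨Y, hY, rfl⟩ := h
  obtain ⟨Z, hZ, rfl⟩ := h'
  have := (hY.eventuallyEq hZ 1).eq_of_nhds
  rwa [s.target] at this

theorem IsPoincareValue.poincareMap_eq {p q : ℂ[X]} {a b w v : ℂ} {s : Path a b}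
    (h : IsPoincareValue p q s w v) : poincareMap p q s w = v := by
  have h' : ∃ v, IsPoincareValue p q s w v := ⟨v, h⟩
  rw [poincareMap, dif_pos h']
  exact h'.choose_spec.unique h

/-! ### Tubes of solutions -/

/-- The continuation `Y` of a solution along `s`, up to the parameter `T`, belongs to a family of
solutions `Θ w t` on discs of a fixed radius about the points `s t`, with initial value `w` near
`w₀`, compatible for nearby parameters and analytic in the initial value. -/
def HasSolutionTube (p q : ℂ[X]) {a b : ℂ} (s : Path a b) (Y : unitInterval → ℂ → ℂ) (w₀ : ℂ)
    (T : unitInterval) : Prop :=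
  ∃ ε > 0, ∃ U ∈ 𝓝 w₀, ∃ Θ : ℂ → unitInterval → ℂ → ℂ,
    (∀ w ∈ U, Θ w 0 a = w) ∧
    (∀ w ∈ U, ∀ t ≤ T, IsAbelSolutionOn p q (Θ w t) (Metric.ball (s t) ε)) ∧
    (∀ w ∈ U, ∀ t ≤ T, ∀ᶠ t' in 𝓝 t, t' ≤ T →
      Set.EqOn (Θ w t') (Θ w t) (Metric.ball (s t) ε ∩ Metric.ball (s t') ε)) ∧
    (∀ t ≤ T, Θ w₀ t =ᶠ[𝓝 (s t)] Y t) ∧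
    ∀ t ≤ T, AnalyticAt ℂ (fun w => Θ w t (s t)) w₀

namespace HasSolutionTube

variable {p q : ℂ[X]} {a b w₀ : ℂ} {s : Path a b} {Y : unitInterval → ℂ → ℂ}

theorem anti {T₁ T₂ : unitInterval} (h : HasSolutionTube p q s Y w₀ T₂) (hT : T₁ ≤ T₂) :
    HasSolutionTube p q s Y w₀ T₁ := by
  obtain ⟨ε, hε, U, hU, Θ, h1, h2, h3, h4, h5⟩ := h
  exact ⟨ε, hε, U, hU, Θ, h1, fun w hw t ht => h2 w hw t (ht.trans hT),
    fun w hw t ht => (h3 w hw t (ht.trans hT)).mono fun t' h ht' => h (ht'.trans hT),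
    fun t ht => h4 t (ht.trans hT), fun t ht => h5 t (ht.trans hT)⟩

theorem zero (hY : IsLocalAbelSolution p q a w₀ (Y 0)) : HasSolutionTube p q s Y w₀ 0 := by
  obtain ⟨ρ, hρ, G, hG⟩ := exists_local_flow p q a w₀
  have ha := Metric.mem_ball_self (x := a) hρ
  have hw₀ := Metric.mem_ball_self (x := w₀) hρ
  have h0 (t : unitInterval) (ht : t ≤ 0) : t = 0 := le_antisymm ht t.2.1
  refine ⟨ρ, hρ, Metric.ball w₀ ρ, Metric.ball_mem_nhds _ hρ, fun w _ => G a w,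
    fun w hw => ((hG a ha).1 w hw).1, fun w hw t ht => ?_,
    fun w hw t ht => Eventually.of_forall fun t' _ x _ => rfl, fun t ht => ?_, fun t ht => ?_⟩
  · rw [h0 t ht, s.source]
    exact ((hG a ha).1 w hw).2
  · rw [h0 t ht, s.source]
    refine IsLocalAbelSolution.eventuallyEq (p := p) (q := q) (w := w₀) ?_ hY
    obtain ⟨h1, h2⟩ := (hG a ha).1 w₀ hw₀
    exact ⟨h1, Filter.eventually_of_mem (Metric.ball_mem_nhds a hρ) h2⟩
  · rw [h0 t ht, s.source]
    exact ((hG a ha).2 a ha).analyticAt (Metric.ball_mem_nhds w₀ hρ)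

/-- A tube up to `T₁` extends over a parameter interval on which the path stays in a disc with a
local flow and the continued solution is a single function `η`. -/
theorem extend {T₁ T₂ : unitInterval} (h : HasSolutionTube p q s Y w₀ T₁) {x₀ y₀ : ℂ} {ρ r : ℝ}
    (hr : 0 < r) (hrρ : r ≤ ρ) {G : ℂ → ℂ → ℂ → ℂ}
    (hG : ∀ x₁ ∈ Metric.ball x₀ ρ,
      (∀ v ∈ Metric.ball y₀ ρ, G x₁ v x₁ = v ∧ IsAbelSolutionOn p q (G x₁ v) (Metric.ball x₀ ρ)) ∧
      ∀ x ∈ Metric.ball x₀ ρ, DifferentiableOn ℂ (fun v => G x₁ v x) (Metric.ball y₀ ρ))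
    {η : ℂ → ℂ} (hη : IsAbelSolutionOn p q η (Metric.ball x₀ r))
    (hT : T₁ ≤ T₂) (hs : ∀ t ∈ Set.Icc T₁ T₂, s t ∈ Metric.ball x₀ (r / 2))
    (hY : ∀ t ∈ Set.Icc T₁ T₂, Y t =ᶠ[𝓝 (s t)] η) (hη₁ : η (s T₁) ∈ Metric.ball y₀ ρ) :
    HasSolutionTube p q s Y w₀ T₂ := by
  obtain ⟨ε, hε, U, hU, Θ, h1, h2, h3, h4, h5⟩ := h
  have hT₁ : T₁ ∈ Set.Icc T₁ T₂ := ⟨le_rfl, hT⟩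
  have hsr (t) (ht : t ∈ Set.Icc T₁ T₂) : s t ∈ Metric.ball x₀ r :=
    Metric.ball_subset_ball (by linarith) (hs t ht)
  have hsρ (t) (ht : t ∈ Set.Icc T₁ T₂) : s t ∈ Metric.ball x₀ ρ :=
    Metric.ball_subset_ball hrρ (hsr t ht)
  obtain ⟨hG1, hG2⟩ := hG (s T₁) (hsρ T₁ hT₁)
  set v : ℂ → ℂ := fun w => Θ w T₁ (s T₁) with hv
  have hv₀ : v w₀ = η (s T₁) := ((h4 T₁ le_rfl).trans (hY T₁ hT₁)).eq_of_nhds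
  have hvan : AnalyticAt ℂ v w₀ := h5 T₁ le_rfl
  have hvb : Metric.ball y₀ ρ ∈ 𝓝 (v w₀) := Metric.isOpen_ball.mem_nhds (by rwa [hv₀])
  -- With radius at most `r / 2`, the discs about the points `s t` stay inside `ball x₀ r`.
  have hε' : 0 < min ε (r / 2) := lt_min hε (half_pos hr)
  have hsub (t) (ht : t ∈ Set.Icc T₁ T₂) :
      Metric.ball (s t) (min ε (r / 2)) ⊆ Metric.ball x₀ r := by
    refine Metric.ball_subset_ball' ?_
    have h := Metric.mem_ball.1 (hs t ht)
    have := min_le_right ε (r / 2)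
    linarith
  have hsubε (t) : Metric.ball (s t) (min ε (r / 2)) ⊆ Metric.ball (s t) ε :=
    Metric.ball_subset_ball (min_le_left _ _)
  have hGr {w : ℂ} (hw : v w ∈ Metric.ball y₀ ρ) :
      IsAbelSolutionOn p q (G (s T₁) (v w)) (Metric.ball x₀ r) :=
    (hG1 _ hw).2.mono (Metric.ball_subset_ball hrρ)
  -- Past `T₁` the family is restarted by the flow at `s T₁` from the value `v w` reached there; `U`
  -- is cut down so that this value is admissible.
  refine ⟨min ε (r / 2), hε', U ∩ v ⁻¹' Metric.ball y₀ ρ,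
    inter_mem hU (hvan.continuousAt.preimage_mem_nhds hvb),
    fun w t => if t ≤ T₁ then Θ w t else G (s T₁) (v w), fun w hw => ?_, fun w hw t ht => ?_,
    fun w hw t ht => ?_, fun t ht => ?_, fun t ht => ?_⟩
  · have h0 : (0 : unitInterval) ≤ T₁ := T₁.2.1
    simpa only [if_pos h0] using h1 w hw.1
  · dsimp only
    split_ifs with htT
    · exact (h2 w hw.1 t htT).mono (hsubε t)
    · exact (hGr hw.2).mono (hsub t ⟨(not_le.1 htT).le, ht⟩)
  · have hmono (t') (h : Set.EqOn (Θ w t') (Θ w t) (Metric.ball (s t) ε ∩ Metric.ball (s t') ε)) :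
        Set.EqOn (Θ w t') (Θ w t)
          (Metric.ball (s t) (min ε (r / 2)) ∩ Metric.ball (s t') (min ε (r / 2))) :=
      h.mono (Set.inter_subset_inter (hsubε t) (hsubε t'))
    rcases lt_trichotomy t T₁ with hlt | rfl | hgt
    · filter_upwards [h3 w hw.1 t hlt.le, Iio_mem_nhds hlt] with t' h h' _
      rw [if_pos (le_of_lt h'), if_pos hlt.le]
      exact hmono t' (h (le_of_lt h'))
    · filter_upwards [h3 w hw.1 t le_rfl] with t' h _
      rw [if_pos le_rfl]
      split_ifs with h'
      · exact hmono t' (h h')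
      -- At the junction the old and the restarted solution agree at `s T₁`, hence on the disc.
      · refine Set.EqOn.mono Set.inter_subset_left ?_
        exact ((hGr hw.2).mono (hsub t hT₁)).eqOn_ball ((h2 w hw.1 t le_rfl).mono (hsubε t))
          (Metric.mem_ball_self hε') (hG1 _ hw.2).1
    · filter_upwards [Ioi_mem_nhds hgt] with t' h' _
      rw [if_neg (not_le.2 hgt), if_neg (not_le.2 h')]
      exact fun x _ => rfl
  · dsimp only
    split_ifs with htT
    · exact h4 t htT
    · have htI : t ∈ Set.Icc T₁ T₂ := ⟨(not_le.1 htT).le, ht⟩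
      have hw : v w₀ ∈ Metric.ball y₀ ρ := by rwa [hv₀]
      have := (hGr hw).eqOn_ball hη (hsr T₁ hT₁) ((hG1 _ hw).1.trans hv₀)
      exact (this.eventuallyEq_of_mem (Metric.isOpen_ball.mem_nhds (hsr t htI))).trans
        (hY t htI).symm
  · dsimp only
    split_ifs with htT
    · exact h5 t htT
    · have htI : t ∈ Set.Icc T₁ T₂ := ⟨(not_le.1 htT).le, ht⟩
      exact ((hG2 (s t) (hsρ t htI)).analyticAt hvb).comp_of_eq hvan rfl

/-- Near any parameter `t`, a local flow about `s t` carries a tube forward and restriction carries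
it back, so having a tube is a locally constant property. -/
theorem of_isContinuedSolution (hY : IsContinuedSolution p q s w₀ Y) (T : unitInterval) :
    HasSolutionTube p q s Y w₀ T := by
  refine unitInterval_forall_of_eventually_iff (zero hY.1) (fun t => ?_) T
  obtain ⟨ρ, hρ, G, hG⟩ := exists_local_flow p q (s t) (Y t (s t))
  obtain ⟨R, hR, hη⟩ := Metric.eventually_nhds_iff_ball.1 (hY.eventually_hasDerivAt t)
  have hr : 0 < min ρ R := lt_min hρ hR
  have hη' : IsAbelSolutionOn p q (Y t) (Metric.ball (s t) (min ρ R)) :=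
    fun x hx => hη x (Metric.ball_subset_ball (min_le_right _ _) hx)
  have e1 : ∀ᶠ t' in 𝓝 t, s t' ∈ Metric.ball (s t) (min ρ R / 2) :=
    s.continuous.continuousAt.eventually (Metric.ball_mem_nhds _ (half_pos hr))
  have e2 : ∀ᶠ t' in 𝓝 t, Y t (s t') ∈ Metric.ball (Y t (s t)) ρ :=
    ((hY.2.1 t).continuousAt.comp s.continuous.continuousAt).eventually
      (Metric.ball_mem_nhds _ hρ)
  obtain ⟨δ, hδ, hN⟩ := Metric.eventually_nhds_iff_ball.1 (e1.and (e2.and (hY.2.2 t)))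
  have hconv : ∀ t₁ ∈ Metric.ball t δ, ∀ t₂ ∈ Metric.ball t δ, Set.Icc t₁ t₂ ⊆ Metric.ball t δ := by
    intro t₁ h₁ t₂ h₂ t' ht'
    rw [Metric.mem_ball, Subtype.dist_eq, Real.dist_eq, abs_lt] at h₁ h₂ ⊢
    have h3 : (t₁ : ℝ) ≤ t' := ht'.1
    have h4 : (t' : ℝ) ≤ t₂ := ht'.2
    exact ⟨by linarith [h₁.1], by linarith [h₂.2]⟩
  have key : ∀ t₁ ∈ Metric.ball t δ, ∀ t₂ ∈ Metric.ball t δ,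
      HasSolutionTube p q s Y w₀ t₁ → HasSolutionTube p q s Y w₀ t₂ := by
    intro t₁ h₁ t₂ h₂ h
    rcases le_total t₂ t₁ with hle | hle
    · exact h.anti hle
    · exact h.extend hr (min_le_left _ _) hG hη' hle
        (fun t' ht' => (hN t' (hconv t₁ h₁ t₂ h₂ ht')).1)
        (fun t' ht' => (hN t' (hconv t₁ h₁ t₂ h₂ ht')).2.2) (hN t₁ h₁).2.1
  filter_upwards [Metric.ball_mem_nhds t hδ] with t' ht'
  exact ⟨key t' ht' t (Metric.mem_ball_self hδ), key t (Metric.mem_ball_self hδ) t' ht'⟩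

end HasSolutionTube

/-! ### Poincaré maps of nearby paths -/

/-- If a solution is regular along `s`, then nearby initial values have along all paths uniformly
close to `s` the same Poincaré value, which is analytic in the initial value. -/
theorem IsRegularAlong.exists_analyticAt {p q : ℂ[X]} {a b w₀ : ℂ} {s : Path a b}
    (h : IsRegularAlong p q s w₀) :
    ∃ ε > 0, ∃ F : ℂ → ℂ, AnalyticAt ℂ F w₀ ∧ ∀ᶠ w in 𝓝 w₀, ∀ s' : Path a b,
      (∀ τ, dist (s' τ) (s τ) < ε) → IsPoincareValue p q s' w (F w) := by
  obtain ⟨Y, hY⟩ := h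
  obtain ⟨ε, hε, U, hU, Θ, h1, h2, h3, -, h5⟩ := HasSolutionTube.of_isContinuedSolution hY 1
  -- The same family `Θ w` continues the solution along `s'`, as `s' t` lies in the disc about `s
  -- t`.
  refine ⟨ε, hε, fun w => Θ w 1 b, by simpa using h5 1 le_rfl,
    Filter.eventually_of_mem hU fun w hw s' hs' => ⟨Θ w, ⟨⟨h1 w hw, ?_⟩, fun t => ?_, fun t => ?_⟩,
      rfl⟩⟩
  · have h := h2 w hw 0 zero_le_one
    rw [s.source] at h
    exact Filter.eventually_of_mem (Metric.ball_mem_nhds a hε) h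
  · exact (h2 w hw t t.2.2).analyticOnNhd Metric.isOpen_ball _ (hs' t)
  · have hc : ∀ᶠ t' in 𝓝 t, s' t' ∈ Metric.ball (s t) ε :=
      s'.continuous.continuousAt.eventually (Metric.isOpen_ball.mem_nhds (hs' t))
    filter_upwards [h3 w hw t t.2.2, hc] with t' h4 h5
    exact (h4 t'.2.2).eventuallyEq_of_mem
      ((Metric.isOpen_ball.inter Metric.isOpen_ball).mem_nhds ⟨h5, hs' t'⟩)

theorem IsRegularAlong.poincareGermDefined {p q : ℂ[X]} {a b w₀ : ℂ} {s : Path a b}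
    (h : IsRegularAlong p q s w₀) : PoincareGermDefined p q s w₀ := by
  obtain ⟨ε, hε, F, -, hF⟩ := h.exists_analyticAt
  refine hF.mono fun w hw => ?_
  have := hw s fun τ => by simpa using hε
  exact ⟨F w, this, fun v hv => hv.unique this⟩

/-- The paths of a homotopy depend continuously on the parameter, uniformly along the path. -/
theorem Path.Homotopy.eventually_dist_eval_lt {a b : ℂ} {s s₁ : Path a b} (H : Path.Homotopy s s₁)
    (t : unitInterval) {ε : ℝ} (hε : 0 < ε) :
    ∀ᶠ t' in 𝓝 t, ∀ τ, dist (H.eval t' τ) (H.eval t τ) < ε := by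
  have hu := CompactSpace.uniformContinuous_of_continuous H.continuous
  obtain ⟨δ, hδ, h⟩ := Metric.uniformContinuous_iff.1 hu ε hε
  filter_upwards [Metric.ball_mem_nhds t hδ] with t' ht' τ
  exact h (a := (t', τ)) (b := (t, τ)) (by simpa [Prod.dist_eq, hδ] using ht')

/-- The Poincaré maps of a family of paths along which the solutions with initial values `σ t` are
regular form an analytic continuation along `σ`. -/
theorem isAnalyticContinuation_poincareMap {p q : ℂ[X]} {a b w₀ w₁ : ℂ} {σ : Path w₀ w₁}
    {s s₁ : Path a b} {H : Path.Homotopy s s₁}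
    (hreg : ∀ t : unitInterval, IsRegularAlong p q (H.eval t) (σ t)) :
    IsAnalyticContinuation σ fun t => poincareMap p q (H.eval t) := by
  refine ⟨fun t => ?_, fun t => ?_⟩ <;>
    obtain ⟨ε, hε, F, hFan, hF⟩ := (hreg t).exists_analyticAt
  · exact hFan.congr (hF.mono fun w hw =>
      (hw (H.eval t) fun τ => by simpa using hε).poincareMap_eq.symm)
  -- The function `F` obtained at `t` computes both maps near `σ t'`.
  · filter_upwards [H.eventually_dist_eval_lt t hε,
      σ.continuous.continuousAt.eventually hF.eventually_nhds] with t' h1 h2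
    filter_upwards [h2] with w hw
    rw [(hw (H.eval t') h1).poincareMap_eq,
      (hw (H.eval t) fun τ => by simpa using hε).poincareMap_eq]

/-- `H` is the family of paths `s_t = H.eval t` from `a` to `b`, with `s_0 = s` and `s_1 = s₁`. -/
theorem theorem3p1 (p q : ℂ[X]) {a b : ℂ} {w₀ w₁ : ℂ} (σ : Path w₀ w₁)
    (s s₁ : Path a b) (H : Path.Homotopy s s₁)
    (hreg : ∀ t : unitInterval, IsRegularAlong p q (H.eval t) (σ t)) :
    PoincareGermDefined p q s w₀ ∧ PoincareGermDefined p q s₁ w₁ ∧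
      (∃ Φ : unitInterval → ℂ → ℂ, IsAnalyticContinuation σ Φ ∧ Φ 0 =ᶠ[𝓝 w₀] poincareMap p q s) ∧
      ∀ Φ : unitInterval → ℂ → ℂ, IsAnalyticContinuation σ Φ → Φ 0 =ᶠ[𝓝 w₀] poincareMap p q s →
        Φ 1 =ᶠ[𝓝 w₁] poincareMap p q s₁ := by
  have hΦ := isAnalyticContinuation_poincareMap hreg
  have h0 := hreg 0
  have h1 := hreg 1
  rw [H.eval_zero, σ.source] at h0
  rw [H.eval_one, σ.target] at h1
  refine ⟨h0.poincareGermDefined, h1.poincareGermDefined,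
    ⟨_, hΦ, by rw [H.eval_zero]⟩, fun Φ hc h => ?_⟩
  have h' := hc.eventuallyEq hΦ (by rwa [H.eval_zero]) 1
  rwa [σ.target, H.eval_one] at h'
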